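/- Let $q\in(0,1)$, let $a\neq 0$ and $b<0$ be real with $|a|<|b|$, and put $$\kappa=-\frac{\log|b/a|}{\log(1/q)}.$$ Let $\varphi:[0,\infty)\to\mathbb{R}$ be continuous, let $\xi\in\mathbb{R}$, and let $z$ be the solution of $$z'(t)=a\,z(qt)+b\,z(t)+\varphi(t),\quad t\ge 0;\qquad z(0)=\xi .$$ Let $\gamma:[0,\infty)\to(0,\infty)$ be measurable and regularly varying at infinity, that is, for some $\eta\in\mathbb{R}$, $\lim_{t\to\infty}\gamma(\lambda t)/\gamma(t)=\lambda^{\eta}$ for every $\lambda>0$. If $\varphi(t)=O(\gamma(t))$ as $t\to\infty$, then $$z(t)=O\!\left(t^{\kappa}\int_1^t\frac{\gamma(s)}{s^{\kappa+1}}\,ds\right),\qquad t\to\infty .$$ Here the integral is the Lebesgue integral with values in $[0,\infty]$ (it is finite for every $t\geq 1$ when $\gamma$ is locally integrable on $[1,\infty)$, and the estimate is then an estimate between real functions). -/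

import Mathlib

open Filter Topology Asymptotics MeasureTheory

/-- `γ : [0,∞) → (0,∞)` (given as a function on `ℝ` of which only the values on `[0,∞)` matter) is
Lebesgue measurable and regularly varying at infinity with index `η`:
`γ (l t) / γ t → l ^ η` as `t → ∞`, for every `l > 0`. -/
structure RegularlyVaryingWithIndex (γ : ℝ → ℝ) (η : ℝ) : Prop where
  pos : ∀ t : ℝ, 0 ≤ t → 0 < γ t
  aemeasurable : AEMeasurable γ (volume.restrict (Set.Ici (0 : ℝ)))
  tendsto_ratio : ∀ l : ℝ, 0 < l → Tendsto (fun t : ℝ => γ (l * t) / γ t) atTop (𝓝 (l ^ η))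

/-- `γ` is regularly varying at infinity (with some real index). -/
def RegularlyVarying (γ : ℝ → ℝ) : Prop :=
  ∃ η : ℝ, RegularlyVaryingWithIndex γ η

/-- `z` solves `z'(t) = a z(q t) + b z(t) + φ(t)` for `t ≥ 0`, `z(0) = ξ`
(the derivative at `t = 0` is the right derivative; only values on `[0,∞)` matter). -/
structure IsPantographSolution (a b q ξ : ℝ) (φ z : ℝ → ℝ) : Prop where
  initial : z 0 = ξ
  hasDeriv : ∀ t : ℝ, 0 ≤ t →
    HasDerivWithinAt z (a * z (q * t) + b * z t + φ t) (Set.Ici (0 : ℝ)) t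

/-- The exponent `κ = - log |b/a| / log (1/q)`. -/
noncomputable def pantographExponent (a b q : ℝ) : ℝ :=
  -(Real.log |b / a| / Real.log (1 / q))

/-! Write `β = -b`, `k = κ` and `J t` for the integral of `γ s / s ^ (k + 1)` over `[1, t]`. Since
`|a| q ^ k = β`, the power `t ^ k` balances the delayed and damping terms; a lower-order correction
makes it a supersolution `v` (`pantograph_supersolution`). The bound `|z| ≤ C v J` is propagated by
first exit (`abs_le_mul_of_forall_first_contact`). At a contact the delayed term carries `J (q t)`
rather than `J t`. By regular variation this saves at least `δ γ(t) t ^ (-k)`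
(`exists_eventually_le_setLIntegral`); multiplied by `|a| v (q t)`, which is at least `β t ^ k / 2`,
the saving dominates `φ` once `C` is large. -/

theorem eventually_lt_nhdsGT_of_hasDerivWithinAt {f g : ℝ → ℝ} {f' g' t : ℝ}
    (hf : HasDerivWithinAt f f' (Set.Ici t) t) (hg : HasDerivWithinAt g g' (Set.Ici t) t)
    (hle : f t ≤ g t) (hlt : f t = g t → f' < g') : ∀ᶠ s in 𝓝[>] t, f s < g s := by
  have hfg := (hg.sub hf).mono Set.Ioi_subset_Ici_self
  rcases hle.lt_or_eq with h | h
  · have := hfg.continuousWithinAt.eventually (lt_mem_nhds (show (0 : ℝ) < (g - f) t by simpa))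
    filter_upwards [this] with s hs
    simpa using hs
  · rw [hasDerivWithinAt_iff_tendsto_slope' (by simp)] at hfg
    have := hfg.eventually (lt_mem_nhds (sub_pos.2 (hlt h)))
    filter_upwards [this, self_mem_nhdsWithin] with s hs hst
    have hst : t < s := hst
    rw [slope_def_field, lt_div_iff₀ (sub_pos.2 hst)] at hs
    simp only [Pi.sub_apply, h] at hs
    linarith

/-- First-exit comparison with a bound `v * J`, where `J` is monotone but not necessarily
continuous. -/
theorem abs_le_mul_of_forall_first_contact {z v J z' v' : ℝ → ℝ} {T₀ T : ℝ} (hT : T₀ ≤ T)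
    (hz : ∀ t, T ≤ t → HasDerivWithinAt z (z' t) (Set.Ici T) t)
    (hv : ∀ t, T ≤ t → HasDerivAt v (v' t) t) (hv0 : ∀ t, T ≤ t → 0 ≤ v t)
    (hJ : MonotoneOn J (Set.Ici T))
    (hinit : ∀ t, T₀ ≤ t → t ≤ T → |z t| ≤ v t * J t)
    (hup : ∀ t, T ≤ t → (∀ s, T₀ ≤ s → s ≤ t → |z s| ≤ v s * J s) →
      z t = v t * J t → z' t < v' t * J t)
    (hlow : ∀ t, T ≤ t → (∀ s, T₀ ≤ s → s ≤ t → |z s| ≤ v s * J s) →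
      -z t = v t * J t → -z' t < v' t * J t)
    {t : ℝ} (ht : T₀ ≤ t) : |z t| ≤ v t * J t := by
  by_contra! hbad
  set B : Set ℝ := {s | T ≤ s ∧ v s * J s < |z s|} with hB
  have htB : t ∈ B := ⟨by
    by_contra! h
    exact absurd (hinit t ht h.le) hbad.not_ge, hbad⟩
  have hbdd : BddBelow B := ⟨T, fun s hs => hs.1⟩
  set m := sInf B with hm
  have hTm : T ≤ m := le_csInf ⟨t, htB⟩ fun s hs => hs.1
  have hgood_lt : ∀ s, T₀ ≤ s → s < m → |z s| ≤ v s * J s := by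
    intro s hs hsm
    rcases le_total s T with h | h
    · exact hinit s hs h
    · by_contra! h'
      exact (csInf_le hbdd (show s ∈ B from ⟨h, h'⟩)).not_gt hsm
  have hzm : |z m| ≤ v m * J m := by
    rcases hTm.eq_or_lt with h | h
    · rw [← h]; exact hinit T hT le_rfl
    -- `J` may jump at `m`, so it is replaced by the larger constant `J m` before the limit from the
    -- left.
    · have hcz : ContinuousWithinAt (fun s => |z s|) (Set.Ioo T m) m :=
        ((hz m hTm).continuousWithinAt.mono fun s hs => hs.1.le).abs
      have hcv : ContinuousWithinAt (fun s => v s * J m) (Set.Ioo T m) m :=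
        ((hv m hTm).continuousAt.mul continuousAt_const).continuousWithinAt
      have : (𝓝[Set.Ioo T m] m).NeBot := by
        rw [nhdsWithin_Ioo_eq_nhdsLT h]; infer_instance
      refine le_of_tendsto_of_tendsto hcz hcv ?_
      filter_upwards [self_mem_nhdsWithin] with s hs
      exact (hgood_lt s (hT.trans hs.1.le) hs.2).trans
        (mul_le_mul_of_nonneg_left (hJ hs.1.le hTm hs.2.le) (hv0 s hs.1.le))
  have hgood : ∀ s, T₀ ≤ s → s ≤ m → |z s| ≤ v s * J s := by
    intro s hs hsm
    rcases hsm.eq_or_lt with h | h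
    · rwa [h]
    · exact hgood_lt s hs h
  have hzd := (hz m hTm).mono (Set.Ici_subset_Ici.2 hTm)
  -- Freezing `J` at `J m` gives a differentiable barrier; to the right of `m` it lies below `v *
  -- J`.
  have hvd : HasDerivWithinAt (fun s => v s * J m) (v' m * J m) (Set.Ici m) m :=
    ((hv m hTm).mul_const (J m)).hasDerivWithinAt
  have h1 := eventually_lt_nhdsGT_of_hasDerivWithinAt hzd hvd ((le_abs_self _).trans hzm)
    (hup m hTm hgood)
  have h2 := eventually_lt_nhdsGT_of_hasDerivWithinAt hzd.neg hvd ((neg_le_abs _).trans hzm)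
    (hlow m hTm hgood)
  obtain ⟨r, hmr, hr⟩ := (mem_nhdsGT_iff_exists_Ioo_subset).1 (h1.and h2)
  obtain ⟨s, hsB, hsr⟩ := exists_lt_of_csInf_lt ⟨t, htB⟩ hmr
  have hms : m < s := by
    refine (csInf_le hbdd hsB).lt_of_ne fun h => ?_
    have := hsB.2
    rw [← hm] at h
    rw [← h] at this
    exact this.not_ge hzm
  obtain ⟨h3, h4⟩ := hr ⟨hms, hsr⟩
  have h5 : |z s| < v s * J m := abs_lt.2 ⟨by simp at h4; linarith, h3⟩
  exact absurd (h5.trans_le (mul_le_mul_of_nonneg_left (hJ hTm hsB.1 hms.le) (hv0 s hsB.1)))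
    hsB.2.not_gt

/-! ### Integrals of regularly varying functions -/

theorem RegularlyVaryingWithIndex.aemeasurable_comp_mul_left {γ : ℝ → ℝ} {η : ℝ}
    (hγ : RegularlyVaryingWithIndex γ η) {t : ℝ} (ht : 0 < t) :
    AEMeasurable (fun u => γ (t * u)) (volume.restrict (Set.Ici (0 : ℝ))) := by
  refine hγ.aemeasurable.comp_quasiMeasurePreserving (f := fun u : ℝ => t * u) ?_
  have h : Measure.QuasiMeasurePreserving (fun u : ℝ => t * u) volume volume :=
    ⟨measurable_const_mul t, by
      rw [Real.map_volume_mul_left ht.ne']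
      exact Measure.smul_absolutelyContinuous⟩
  exact h.restrict fun u (hu : 0 ≤ u) => mul_nonneg ht.le hu

/-- Lower bound for the integral of a regularly varying function over `(q t, t]`. -/
theorem RegularlyVaryingWithIndex.exists_eventually_le_setLIntegral {γ : ℝ → ℝ} {η : ℝ}
    (hγ : RegularlyVaryingWithIndex γ η) {q : ℝ} (hq0 : 0 < q) (hq1 : q < 1) (p : ℝ) :
    ∃ δ : ℝ, 0 < δ ∧ ∀ᶠ t : ℝ in atTop, ENNReal.ofReal (δ * (γ t * t ^ (-p))) ≤
      ∫⁻ s in Set.Ioc (q * t) t, ENNReal.ofReal (γ s / s ^ (p + 1)) := by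
  set F : ℝ → ℝ → ENNReal := fun t u => ENNReal.ofReal (γ (t * u) / γ t / u ^ (p + 1)) with hF
  have hmeas : ∀ t, 0 < t → AEMeasurable (F t) (volume.restrict (Set.Ioc q 1)) := by
    intro t ht
    refine AEMeasurable.ennreal_ofReal (((AEMeasurable.mono_measure
      (hγ.aemeasurable_comp_mul_left ht) (Measure.restrict_mono ?_ le_rfl)).div_const _).div ?_)
    · exact fun u hu => hq0.le.trans hu.1.le
    · exact (measurable_id.pow_const _).aemeasurable
  have hscale : ∀ t, 0 < t → ∫⁻ s in Set.Ioc (q * t) t, ENNReal.ofReal (γ s / s ^ (p + 1)) =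
      ENNReal.ofReal (γ t * t ^ (-p)) * ∫⁻ u in Set.Ioc q 1, F t u := by
    intro t ht
    have himg : (fun u => t * u) '' Set.Ioc q 1 = Set.Ioc (q * t) t := by
      rw [Set.image_mul_left_Ioc ht, mul_one, mul_comm]
    rw [← himg, lintegral_image_eq_lintegral_abs_deriv_mul (f' := fun _ => t) measurableSet_Ioc
      (fun u _ => by simpa using ((hasDerivAt_id u).const_mul t).hasDerivWithinAt)
      (mul_right_injective₀ ht.ne').injOn, ← lintegral_const_mul' _ _ ENNReal.ofReal_ne_top]
    refine setLIntegral_congr_fun measurableSet_Ioc fun u hu => ?_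
    have hu0 : 0 < u := hq0.trans hu.1
    have hγt := hγ.pos t ht.le
    simp only [hF]
    rw [← ENNReal.ofReal_mul (abs_nonneg _), ← ENNReal.ofReal_mul (by positivity), abs_of_pos ht,
      Real.mul_rpow ht.le hu0.le, Real.rpow_neg ht.le, Real.rpow_add_one ht.ne']
    congr 1
    field_simp
  set L : ENNReal := ∫⁻ u in Set.Ioc q 1, ENNReal.ofReal (u ^ η / u ^ (p + 1)) with hL
  have hLpos : 0 < L := by
    rw [hL, setLIntegral_pos_iff (by fun_prop)]
    have : Set.Ioc q 1 ⊆
        (Function.support fun u : ℝ => ENNReal.ofReal (u ^ η / u ^ (p + 1))) ∩ Set.Ioc q 1 := by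
      intro u hu
      have hu0 : 0 < u := hq0.trans hu.1
      refine ⟨?_, hu⟩
      simp only [Function.mem_support, ne_eq, ENNReal.ofReal_eq_zero, not_le]
      positivity
    refine lt_of_lt_of_le ?_ (measure_mono this)
    simpa using hq1
  -- The gap below `L` gives room for Fatou and makes `d` finite without bounding `L`.
  obtain ⟨d, hd0, hdL⟩ := exists_between hLpos
  have hdtop : d ≠ ⊤ := hdL.ne_top
  refine ⟨d.toReal, ENNReal.toReal_pos hd0.ne' hdtop, ?_⟩
  -- Fatou along a sequence of failures needs only pointwise convergence of the ratios, not uniform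
  -- convergence.
  have key : ∀ᶠ t : ℝ in atTop, d ≤ ∫⁻ u in Set.Ioc q 1, F t u := by
    by_contra hcon
    rw [not_eventually] at hcon
    obtain ⟨x, hx, hxlt⟩ := exists_seq_forall_of_frequently
      (hcon.and_eventually (eventually_gt_atTop (0 : ℝ)))
    have hfatou := lintegral_liminf_le' (u := atTop)
      (μ := volume.restrict (Set.Ioc q 1)) (f := fun n => F (x n))
      fun n => hmeas _ (hxlt n).2
    have hlim : ∫⁻ u in Set.Ioc q 1, liminf (fun n => F (x n) u) atTop = L := by
      refine setLIntegral_congr_fun measurableSet_Ioc fun u hu => ?_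
      have hu0 : 0 < u := hq0.trans hu.1
      refine Tendsto.liminf_eq (ENNReal.tendsto_ofReal ?_)
      have := ((hγ.tendsto_ratio u hu0).comp hx).div_const (u ^ (p + 1))
      simpa only [Function.comp_def, mul_comm u] using this
    rw [hlim] at hfatou
    have : liminf (fun n => ∫⁻ u in Set.Ioc q 1, F (x n) u) atTop ≤ d := by
      refine liminf_le_of_le (by isBoundedDefault) fun b hb => ?_
      obtain ⟨n, hn⟩ := hb.exists
      exact hn.trans (not_le.1 (hxlt n).1).le
    exact (hfatou.trans this).not_gt hdL
  filter_upwards [key, eventually_gt_atTop 0] with t ht ht0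
  rw [hscale t ht0, ENNReal.ofReal_mul ENNReal.toReal_nonneg, ENNReal.ofReal_toReal hdtop, mul_comm]
  gcongr

/-! ### The exponent and the supersolution -/

theorem abs_mul_rpow_pantographExponent {a b q : ℝ} (hq0 : 0 < q) (hq1 : q < 1)
    (ha : a ≠ 0) (hb : b < 0) : |a| * q ^ pantographExponent a b q = -b := by
  have hlog : Real.log q ≠ 0 := (Real.log_neg hq0 hq1).ne
  have ha' : 0 < |a| := abs_pos.2 ha
  have hk : Real.log q * pantographExponent a b q = Real.log |b / a| := by
    rw [pantographExponent, one_div, Real.log_inv]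
    field_simp
  rw [Real.rpow_def_of_pos hq0, hk, Real.exp_log (abs_pos.2 (div_ne_zero hb.ne ha)), abs_div,
    mul_div_cancel₀ _ ha'.ne', abs_of_neg hb]

theorem pantographExponent_neg {a b q : ℝ} (hq0 : 0 < q) (hq1 : q < 1)
    (ha : a ≠ 0) (hab : |a| < |b|) : pantographExponent a b q < 0 := by
  have ha' : 0 < |a| := abs_pos.2 ha
  refine neg_neg_of_pos (div_pos (Real.log_pos ?_) (Real.log_pos ?_))
  · rw [abs_div]
    exact (one_lt_div ha').2 hab
  · exact (one_lt_div hq0).2 hq1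

/-- `t ^ k - c t ^ (k - 1)` is a supersolution of the homogeneous pantograph equation. -/
theorem pantograph_supersolution {A β q k c t : ℝ} (hq0 : 0 < q) (hk : k < 0)
    (hAk : A * q ^ k = β) (hc : 0 ≤ c) (hck : c * (β * (1 / q - 1)) = -k) (ht : 0 < t) :
    A * ((q * t) ^ k - c * (q * t) ^ (k - 1)) - β * (t ^ k - c * t ^ (k - 1)) ≤
      k * t ^ (k - 1) - c * ((k - 1) * t ^ (k - 1 - 1)) := by
  have h1 : A * ((q * t) ^ k - c * (q * t) ^ (k - 1)) - β * (t ^ k - c * t ^ (k - 1)) =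
      k * t ^ (k - 1) := by
    -- The `t ^ k` terms cancel; `hck` makes the correction contribute exactly the derivative of `t
    -- ^ k`.
    rw [Real.mul_rpow hq0.le ht.le, Real.mul_rpow hq0.le ht.le, Real.rpow_sub_one hq0.ne']
    linear_combination (t ^ k - c * t ^ (k - 1) / q) * hAk - t ^ (k - 1) * hck
  have h2 : 0 ≤ c * ((1 - k) * t ^ (k - 1 - 1)) :=
    mul_nonneg hc (mul_nonneg (by linarith) (Real.rpow_nonneg ht.le _))
  linarith

/-! ### The estimate for solutions -/

theorem IsPantographSolution.exists_eventually_abs_le {a b q ξ : ℝ} {φ γ z : ℝ → ℝ}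
    (hq0 : 0 < q) (hq1 : q < 1) (ha : a ≠ 0) (hb : b < 0) (hab : |a| < |b|)
    (hz : IsPantographSolution a b q ξ φ z) (hγ : RegularlyVarying γ) (hφγ : φ =O[atTop] γ)
    (hfin : ∀ t : ℝ, ∫⁻ s in Set.Icc (1 : ℝ) t,
      ENNReal.ofReal (γ s / s ^ (pantographExponent a b q + 1)) ≠ ⊤) :
    ∃ C : ℝ, 0 ≤ C ∧ ∀ᶠ t : ℝ in atTop, |z t| ≤ C * (t ^ pantographExponent a b q *
      (∫⁻ s in Set.Icc (1 : ℝ) t,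
        ENNReal.ofReal (γ s / s ^ (pantographExponent a b q + 1))).toReal) := by
  obtain ⟨η, hγ⟩ := hγ
  have hAk := abs_mul_rpow_pantographExponent hq0 hq1 ha hb
  have hk := pantographExponent_neg hq0 hq1 ha hab
  set k := pantographExponent a b q
  obtain ⟨β, rfl⟩ : ∃ β, b = -β := ⟨-b, by ring⟩
  rw [neg_neg] at hAk
  have hβ : 0 < β := by linarith
  have ha' : 0 < |a| := abs_pos.2 ha
  set J : ℝ → ℝ := fun t =>
    (∫⁻ s in Set.Icc (1 : ℝ) t, ENNReal.ofReal (γ s / s ^ (k + 1))).toReal with hJdef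
  have hJ : Monotone J := fun s t hst => ENNReal.toReal_mono (hfin t)
    (lintegral_mono_set (Set.Icc_subset_Icc_right hst))
  have hJ0 : ∀ t, 0 ≤ J t := fun t => ENNReal.toReal_nonneg
  have hq' : 0 < 1 / q - 1 := sub_pos.2 ((one_lt_div hq0).2 hq1)
  obtain ⟨c, hc, hck⟩ : ∃ c : ℝ, 0 ≤ c ∧ c * (β * (1 / q - 1)) = -k :=
    ⟨-k / (β * (1 / q - 1)), div_nonneg (by linarith) (by positivity),
      div_mul_cancel₀ _ (by positivity)⟩
  set v : ℝ → ℝ := fun t => t ^ k - c * t ^ (k - 1) with hv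
  have hvle : ∀ t, 0 < t → v t ≤ t ^ k := fun t ht => by
    have : 0 ≤ c * t ^ (k - 1) := by positivity
    simp only [hv]; linarith
  have hvge : ∀ t, 0 < t → 2 * c ≤ t → t ^ k / 2 ≤ v t := fun t ht hct => by
    have h1 : 0 < t ^ (k - 1) := by positivity
    have h2 : t ^ k = t ^ (k - 1) * t := by
      rw [← Real.rpow_add_one ht.ne']; simp
    simp only [hv]
    rw [h2]
    nlinarith
  obtain ⟨δ, hδ, hδγ⟩ := hγ.exists_eventually_le_setLIntegral hq0 hq1 k
  obtain ⟨K, hK, hKγ⟩ := hφγ.exists_pos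
  obtain ⟨T₁, hT₁⟩ := eventually_atTop.1 (hδγ.and hKγ.bound)
  -- Beyond `T₀`, both `t` and `q * t` are at least `1` and `2 * c`, so `hvge` applies at each.
  set T₀ := max T₁ (max 1 (2 * c) / q) with hT₀
  have hqT : max 1 (2 * c) ≤ q * T₀ := by
    have := (div_le_iff₀' hq0).1 (le_max_right T₁ (max 1 (2 * c) / q))
    exact this
  have hqt1 : ∀ t, T₀ ≤ t → 1 ≤ q * t := fun t ht =>
    (le_max_left _ _).trans (hqT.trans (by gcongr))
  have hqtc : ∀ t, T₀ ≤ t → 2 * c ≤ q * t := fun t ht =>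
    (le_max_right _ _).trans (hqT.trans (by gcongr))
  have hpos : ∀ t, T₀ ≤ t → 0 < t := fun t ht =>
    pos_of_mul_pos_right (one_pos.trans_le (hqt1 t ht)) hq0.le
  have hqt : ∀ t, T₀ ≤ t → q * t ≤ t := fun t ht => by nlinarith [hpos t ht]
  have hJstep : ∀ t, T₀ ≤ t → J (q * t) + δ * (γ t * t ^ (-k)) ≤ J t := by
    intro t ht
    have h0 := hpos t ht
    have hγt := hγ.pos t h0.le
    have hd : Disjoint (Set.Icc 1 (q * t)) (Set.Ioc (q * t) t) :=
      Set.disjoint_left.2 fun s hs hs' => hs.2.not_gt hs'.1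
    have h1 := (hT₁ t ((le_max_left _ _).trans ht)).1
    have h2 : (∫⁻ s in Set.Icc 1 (q * t), ENNReal.ofReal (γ s / s ^ (k + 1))) +
        ENNReal.ofReal (δ * (γ t * t ^ (-k))) ≤
        ∫⁻ s in Set.Icc 1 t, ENNReal.ofReal (γ s / s ^ (k + 1)) := by
      rw [← Set.Icc_union_Ioc_eq_Icc (hqt1 t ht) (hqt t ht),
        lintegral_union measurableSet_Ioc hd]
      gcongr
    have h3 := ENNReal.toReal_mono (hfin t) h2
    rwa [ENNReal.toReal_add (hfin _) ENNReal.ofReal_ne_top,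
      ENNReal.toReal_ofReal (by positivity)] at h3
  have hJpos : 0 < J T₀ := by
    have h0 := hpos T₀ le_rfl
    have hγt := hγ.pos T₀ h0.le
    have : 0 < δ * (γ T₀ * T₀ ^ (-k)) := by positivity
    linarith [hJstep T₀ le_rfl, hJ0 (q * T₀)]
  -- For `t ≥ T` the delayed argument `q * t` stays in `[T₀, t]`, where the bound is already known.
  set T := T₀ / q with hT
  have hqT' : q * T = T₀ := mul_div_cancel₀ _ hq0.ne'
  have hT₀T : T₀ ≤ T := by
    rw [hT, le_div_iff₀ hq0]; nlinarith [hpos T₀ le_rfl]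
  have hT0 := hpos T hT₀T
  have hzc : ContinuousOn z (Set.Icc T₀ T) := fun t ht =>
    (hz.hasDeriv t (hpos t ht.1).le).continuousWithinAt.mono
      fun s hs => (hpos s hs.1).le
  obtain ⟨M, hM⟩ := isCompact_Icc.exists_bound_of_continuousOn hzc
  have hm : 0 < T ^ k / 2 * J T₀ := by positivity
  -- The `M` term covers the initial interval `[T₀, T]`; the last beats `φ`, with `+ 1` for
  -- strictness.
  set C := max 0 (max (M / (T ^ k / 2 * J T₀)) (2 * K / (β * δ) + 1)) with hC
  have hC0 : 0 ≤ C := le_max_left _ _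
  have hCM : M ≤ C * (T ^ k / 2 * J T₀) :=
    (div_le_iff₀ hm).1 ((le_max_left _ _).trans (le_max_right _ _))
  have hCK : 2 * K < C * (β * δ) := by
    have : 2 * K / (β * δ) < C := (lt_add_one _).trans_le
      ((le_max_right _ _).trans (le_max_right _ _))
    exact (div_lt_iff₀ (by positivity)).1 this
  have hv0 : ∀ t, T ≤ t → 0 ≤ v t := fun t ht => by
    have h0 := hpos t (hT₀T.trans ht)
    have := hvge t h0 ((hqtc t (hT₀T.trans ht)).trans (hqt t (hT₀T.trans ht)))
    have : 0 < t ^ k := by positivity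
    linarith
  have key : ∀ t, T ≤ t → |z (q * t)| ≤ v (q * t) * (C * J (q * t)) →
      |a| * |z (q * t)| - β * (v t * (C * J t)) + |φ t| <
        (k * t ^ (k - 1) - c * ((k - 1) * t ^ (k - 1 - 1))) * (C * J t) := by
    intro t ht hzq
    have ht' := hT₀T.trans ht
    have h0 := hpos t ht'
    have hγt := hγ.pos t h0.le
    have hφt : |φ t| ≤ K * γ t := by
      have := (hT₁ t ((le_max_left _ _).trans ht')).2
      rwa [Real.norm_eq_abs, Real.norm_eq_abs, abs_of_pos hγt] at this
    have h1 := mul_le_mul_of_nonneg_right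
      (pantograph_supersolution hq0 hk hAk hc hck h0) (mul_nonneg hC0 (hJ0 t))
    have h2 := hvge (q * t) (by positivity) (hqtc t ht')
    have h3 : |a| * |z (q * t)| ≤ |a| * (v (q * t) * (C * J (q * t))) := by gcongr
    have h4 : β / 2 * t ^ k ≤ |a| * v (q * t) := by
      have := mul_le_mul_of_nonneg_left h2 ha'.le
      rw [Real.mul_rpow hq0.le h0.le] at this
      refine le_of_eq_of_le ?_ this
      rw [← hAk]; ring
    -- The saving from `J (q * t)` in place of `J t`; the powers of `t` cancel to leave a multiple
    -- of `γ t`.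
    have h5 : (β / 2 * t ^ k) * (C * (δ * (γ t * t ^ (-k)))) ≤
        |a| * v (q * t) * (C * (J t - J (q * t))) := by
      have h6 := hJstep t ht'
      have h7 : 0 ≤ |a| * v (q * t) := le_trans (by positivity) h4
      gcongr
      linarith
    have h6 : (β / 2 * t ^ k) * (C * (δ * (γ t * t ^ (-k)))) = C * (β * δ) / 2 * γ t := by
      rw [Real.rpow_neg h0.le]
      field_simp
    have h7 : K * γ t < C * (β * δ) / 2 * γ t := by gcongr; linarith
    simp only [hv] at h1 h3 h5 ⊢
    linarith
  refine ⟨C, hC0, ?_⟩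
  filter_upwards [eventually_ge_atTop T₀] with t ht
  have hcmp := abs_le_mul_of_forall_first_contact (J := fun t => C * J t) (v := v) hT₀T
    (fun t ht => (hz.hasDeriv t (hT0.le.trans ht)).mono (Set.Ici_subset_Ici.2 hT0.le))
    (fun t ht => ((Real.hasDerivAt_rpow_const (Or.inl (hT0.trans_le ht).ne')).sub
      ((Real.hasDerivAt_rpow_const (Or.inl (hT0.trans_le ht).ne')).const_mul c)))
    hv0 (fun s _ t _ hst => mul_le_mul_of_nonneg_left (hJ hst) hC0)
    ?_ ?_ ?_ ht
  · have h0 := hpos t ht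
    calc |z t| ≤ v t * (C * J t) := hcmp
      _ ≤ t ^ k * (C * J t) := mul_le_mul_of_nonneg_right (hvle t h0) (mul_nonneg hC0 (hJ0 t))
      _ = C * (t ^ k * J t) := by ring
  · intro s hs hsT
    have h0 := hpos s hs
    have h1 : T ^ k ≤ s ^ k := Real.rpow_le_rpow_of_nonpos h0 hsT hk.le
    have h2 := hvge s h0 ((hqtc s hs).trans (hqt s hs))
    calc |z s| ≤ M := hM s ⟨hs, hsT⟩
      _ ≤ C * (T ^ k / 2 * J T₀) := hCM
      _ = T ^ k / 2 * (C * J T₀) := by ring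
      _ ≤ v s * (C * J s) := by
        have h3 := hJ hs
        have h4 : 0 ≤ v s := le_trans (by positivity) h2
        gcongr
        linarith
  · intro s hs hle heq
    have hs' := hT₀T.trans hs
    have hk' := key s hs (hle (q * s) (hqT' ▸ by gcongr) (hqt s hs'))
    have h1 : a * z (q * s) ≤ |a| * |z (q * s)| := (le_abs_self _).trans_eq (abs_mul _ _)
    have h2 := le_abs_self (φ s)
    rw [heq]
    linarith
  · intro s hs hle heq
    have hs' := hT₀T.trans hs
    have hk' := key s hs (hle (q * s) (hqT' ▸ by gcongr) (hqt s hs'))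
    have h1 : -(a * z (q * s)) ≤ |a| * |z (q * s)| := (neg_le_abs _).trans_eq (abs_mul _ _)
    have h2 := neg_le_abs (φ s)
    rw [← heq] at hk'
    linarith

/-- The big-O estimate is stated first with the Lebesgue integral valued in `[0,∞]`, so that it
needs no integrability of `γ`, and then as an estimate between real functions when `γ` is locally
integrable on `[1,∞)`. -/
theorem mainTheorem5 (a b q ξ : ℝ) (φ γ z : ℝ → ℝ)
    (hq0 : 0 < q) (hq1 : q < 1)
    (ha : a ≠ 0) (hb : b < 0) (hab : |a| < |b|)
    (hφ : ContinuousOn φ (Set.Ici (0 : ℝ)))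
    (hz : IsPantographSolution a b q ξ φ z)
    (hγ : RegularlyVarying γ)
    (hφγ : φ =O[atTop] γ) :
    (∃ C : NNReal, ∀ᶠ t : ℝ in atTop,
      ENNReal.ofReal |z t| ≤
        (C : ENNReal) * (ENNReal.ofReal (t ^ pantographExponent a b q) *
          ∫⁻ s in Set.Icc (1 : ℝ) t,
            ENNReal.ofReal (γ s / s ^ (pantographExponent a b q + 1)))) ∧
    (LocallyIntegrableOn γ (Set.Ici (1 : ℝ)) →
      z =O[atTop] fun t : ℝ =>
        t ^ pantographExponent a b q *
          ∫ s in (1 : ℝ)..t, γ s / s ^ (pantographExponent a b q + 1)) := by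
  have hmain := hz.exists_eventually_abs_le hq0 hq1 ha hb hab hγ hφγ
  set k := pantographExponent a b q
  constructor
  · by_cases hfin : ∀ t : ℝ,
        ∫⁻ s in Set.Icc (1 : ℝ) t, ENNReal.ofReal (γ s / s ^ (k + 1)) ≠ ⊤
    · obtain ⟨C, hC, h⟩ := hmain hfin
      refine ⟨C.toNNReal, ?_⟩
      filter_upwards [h, eventually_gt_atTop 0] with t ht ht0
      refine (ENNReal.ofReal_le_ofReal ht).trans_eq ?_
      rw [ENNReal.ofReal_mul hC, ENNReal.ofReal_mul (by positivity),
        ENNReal.ofReal_toReal (hfin t)]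
      rfl
    -- Once infinite, the integral stays infinite, and `t ^ k > 0` makes the right side `⊤`.
    · push Not at hfin
      obtain ⟨t₀, ht₀⟩ := hfin
      refine ⟨1, ?_⟩
      filter_upwards [eventually_ge_atTop t₀, eventually_gt_atTop 0] with t ht ht0
      have : ∫⁻ s in Set.Icc (1 : ℝ) t, ENNReal.ofReal (γ s / s ^ (k + 1)) = ⊤ :=
        top_le_iff.1 (ht₀ ▸ lintegral_mono_set (Set.Icc_subset_Icc_right ht))
      rw [this, ENNReal.mul_top (by simpa using Real.rpow_pos_of_pos ht0 k)]
      simp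
  · intro hloc
    have hint : ∀ t : ℝ, IntegrableOn (fun s => γ s / s ^ (k + 1)) (Set.Icc 1 t) := by
      intro t
      have h1 : IntegrableOn γ (Set.Icc 1 t) :=
        hloc.integrableOn_compact_subset Set.Icc_subset_Ici_self isCompact_Icc
      have h2 : ContinuousOn (fun s : ℝ => (s ^ (k + 1))⁻¹) (Set.Icc 1 t) := fun s hs => by
        have hs0 : 0 < s := one_pos.trans_le hs.1
        exact ((Real.continuousAt_rpow_const s (k + 1) (Or.inl hs0.ne')).inv₀
          (Real.rpow_pos_of_pos hs0 _).ne').continuousWithinAt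
      simpa only [div_eq_mul_inv] using h1.mul_continuousOn h2 isCompact_Icc
    obtain ⟨η, hγ⟩ := hγ
    obtain ⟨C, hC, h⟩ := hmain fun t => (hint t).lintegral_lt_top.ne
    refine IsBigO.of_bound C ?_
    filter_upwards [h, eventually_ge_atTop 1] with t ht ht1
    have hnn : 0 ≤ᵐ[volume.restrict (Set.Icc 1 t)] fun s => γ s / s ^ (k + 1) := by
      filter_upwards [ae_restrict_mem measurableSet_Icc] with s hs
      have hs0 : 0 < s := one_pos.trans_le hs.1
      have := hγ.pos s hs0.le
      simp only [Pi.zero_apply]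
      positivity
    rw [← integral_eq_lintegral_of_nonneg_ae hnn (hint t).aestronglyMeasurable,
      integral_Icc_eq_integral_Ioc, ← intervalIntegral.integral_of_le ht1] at ht
    refine ht.trans (mul_le_mul_of_nonneg_left (le_abs_self _) ?_)
    assumption
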